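/- For integers $d\ge 2$, $k\ge 0$ and real $B\ge 0$ let $\mathcal H_{2,0}$ be the class of linear predictors $x\mapsto\langle w_a+w_b,x\rangle$ on the closed unit $\ell_2$ ball $\{x\in\mathbb R^d:\|x\|_2\le 1\}$ with $w_a,w_b\in\mathbb R^d$, $\|w_a\|_2^2\le B^2$ and $\|w_b\|_0\le k$, where $\|w\|_0$ is the number of nonzero coordinates of $w$. For a distribution $D$ on pairs $(x,y)$ with $\|x\|_2\le 1$ and $y\in\{\pm1\}$, and a measurable $h$, let $\ell_{\rm ramp}(h,D)=\mathbb E_{(x,y)\sim D}\max(0,\min(1-h(x)y,1))$. The agnostic sample complexity $m(\epsilon,\delta)$ of $\mathcal H_{2,0}$ with respect to the ramp loss is the least $n$ for which there is a (possibly randomized and improper) learning algorithm $A$, with measurable predictors as outputs, such that for every $m\ge n$ and every such $D$, with probability at least $1-\delta$ over an i.i.d. sample $S\sim D^m$ and the internal randomness of $A$, $$\ell_{\rm ramp}(A(S),D)\le\inf_{h\in\mathcal H_{2,0}}\ell_{\rm ramp}(h,D)+\epsilon .$$ Then $m(\epsilon,\delta)$ is $\tilde O\big((k\log d+B^2)/\epsilon^2\big)$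 for every fixed $\delta$: there is a constant $c\in\mathbb N$, and for every $\delta\in(0,1)$ a constant $C_\delta>0$, such that for all integers $d\ge2$, $k\ge0$ and all real $B\ge0$, $\epsilon\in(0,1)$, with $r=(k\log d+B^2)/\epsilon^2$, the sample complexity is finite and $$m(\epsilon,\delta)\le C_\delta\; r\,\big(\log(2+r)\big)^{c}.$$ -/

import Mathlib

open MeasureTheory

noncomputable section

namespace RulesFirst

/-- The label set `{1, -1}`. -/
abbrev Label : Type := ({1, -1} : Set ℝ)

/-- The ramp loss `max (0, min (1 - ŷ y, 1))`. -/
def rampLoss (yhat y : ℝ) : ℝ := max 0 (min (1 - yhat * y) 1)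

section Learning

variable {X : Type*} [MeasurableSpace X]

/-- The expected loss of the predictor `h` on a distribution `D` over labelled examples. -/
def expectedLoss (loss : ℝ → ℝ → ℝ) (h : X → ℝ) (D : Measure (X × Label)) : ℝ :=
  ∫ z, loss (h z.1) (z.2 : ℝ) ∂D

/-- The optimal expected loss over the class `H`. -/
def optimalLoss (loss : ℝ → ℝ → ℝ) (H : Set (X → ℝ)) (D : Measure (X × Label)) : ℝ :=
  ⨅ h : H, expectedLoss loss (h : X → ℝ) D

variable (X) in
/-- A (possibly randomized, possibly improper) learning algorithm: it maps a sample of any size `m`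
and a random seed, drawn from a probability space of the algorithm's own, to a measurable
real-valued predictor. -/
structure Learner where
  /-- The space of random seeds. -/
  Seed : Type
  /-- The σ-algebra of the seed space. -/
  [measurableSpaceSeed : MeasurableSpace Seed]
  /-- The law of the random seed. -/
  seedLaw : Measure Seed
  [isProbabilityMeasure_seedLaw : IsProbabilityMeasure seedLaw]
  /-- The predictor that is returned on a given sample and seed. -/
  run : (m : ℕ) → (Fin m → X × Label) → Seed → X → ℝ
  measurable_run : ∀ m S s, Measurable (run m S s)

attribute [instance] Learner.measurableSpaceSeed Learner.isProbabilityMeasure_seedLaw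

/-- On `m` i.i.d. examples from `D`, the algorithm `A` is `ε`-optimal with respect to `H` with
probability at least `1 - δ`, over the sample and the internal randomness. As no measurability of
`A` in the sample is imposed, this is said by bounding the (outer) measure of the failure event. -/
def Learner.SucceedsOn (A : Learner X) (loss : ℝ → ℝ → ℝ) (H : Set (X → ℝ)) (ε δ : ℝ) (m : ℕ)
    (D : Measure (X × Label)) : Prop :=
  ((Measure.pi fun _ : Fin m => D).prod A.seedLaw)
    {p | optimalLoss loss H D + ε < expectedLoss loss (A.run m p.1 p.2) D} ≤ ENNReal.ofReal δ

/-- The (agnostic) sample complexity of an algorithm: the least `n` such that for all `m ≥ n` and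
all distributions it succeeds on `m` examples; it is `⊤` if there is no such `n`. -/
def Learner.sampleComplexity (A : Learner X) (loss : ℝ → ℝ → ℝ) (H : Set (X → ℝ))
    (ε δ : ℝ) : ℕ∞ :=
  ⨅ (n : ℕ) (_ : ∀ m : ℕ, n ≤ m → ∀ D : Measure (X × Label), IsProbabilityMeasure D →
    A.SucceedsOn loss H ε δ m D), (n : ℕ∞)

/-- The (agnostic) sample complexity of a class: the least one over all algorithms. -/
def sampleComplexity (loss : ℝ → ℝ → ℝ) (H : Set (X → ℝ)) (ε δ : ℝ) : ℕ∞ :=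
  ⨅ A : Learner X, A.sampleComplexity loss H ε δ

end Learning

/-- The closed unit `ℓ₂` ball of `ℝ^d`. -/
abbrev UnitBall (d : ℕ) : Type := Metric.closedBall (0 : EuclideanSpace ℝ (Fin d)) 1

/-- The `ℓ₀` pseudonorm: the number of nonzero coordinates. -/
def zeroNorm {d : ℕ} (w : EuclideanSpace ℝ (Fin d)) : ℕ := {j : Fin d | w j ≠ 0}.ncard

/-- The class `H_{2,0}` of linear predictors on the unit `ℓ₂` ball with weight vector `wa + wb`,
where `‖wa‖₂² ≤ B²` and `‖wb‖₀ ≤ k`. -/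
def classH20 (d k : ℕ) (B : ℝ) : Set (UnitBall d → ℝ) :=
  {h | ∃ wa wb : EuclideanSpace ℝ (Fin d), ‖wa‖ ^ 2 ≤ B ^ 2 ∧ zeroNorm wb ≤ k ∧
    h = fun x : UnitBall d => inner ℝ (wa + wb) (x : EuclideanSpace ℝ (Fin d))}

/-- The leading term `(k log d + B²) / ε²`. -/
def rate (d k : ℕ) (B ε : ℝ) : ℝ := (k * Real.log d + B ^ 2) / ε ^ 2

end RulesFirst

end

/-! The learner is approximate empirical risk minimization over a countable uniformly dense subset
of the class, and everything rests on a bound for the Rademacher averages of the gains `clip (h x *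
y)`.

The dense part `wa` has bounded norm and costs `B * √n` by contraction. The sparse part `wb` has
unbounded weights, so it cannot be covered in norm. However, `clip` saturates: since `⟨wa, x⟩` lies
in `[-B, B]`, only values of `⟨wb, x⟩` in the window `[-(B+1), B+1]` matter. Rounded to a grid of
mesh `γ` on this window, the sparse functionals produce at most `(d * (n * M + 1)) ^ k` vectors of
values on `n` points (`card_sparseCells_le`, from Sauer–Shelah for halfspaces in `ℝ^k`), where `M`
is the number of grid steps.

For each such vector of shifts, the supremum over `wa` is a function of the signs with bounded
differences and mean at most `B * √n`. A maximum over all the vectors therefore adds only `log card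
/ c + c * n / 2` (`sum_iSup_shifted_linear_le`). The supremum over the two parts is thus decoupled,
which gives `k log d + B²` and no product of the two.

Symmetrization and Markov's inequality turn this into a uniform deviation bound. Markov costs a
power of `1/δ`, which is harmless because the constant may depend on `δ`. What remains is
arithmetic: a sample of size `C * r * log (2 + r)` makes every term small. -/

namespace Rademacher

/-! ### Averages over the sign cube: second moments, maximal inequality, contraction. -/

/-- The sign `1` or `-1` encoded by a Boolean. -/
def sgn (b : Bool) : ℝ := if b then 1 else -1

@[simp] lemma sgn_true : sgn true = 1 := rfl

@[simp] lemma sgn_false : sgn false = -1 := rfl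

lemma sgn_not (b : Bool) : sgn (!b) = -sgn b := by cases b <;> simp

lemma abs_sgn (b : Bool) : |sgn b| = 1 := by cases b <;> simp

lemma sum_cons {n : ℕ} (f : (Fin (n + 1) → Bool) → ℝ) :
    ∑ σ, f σ = ∑ τ : Fin n → Bool, (f (Fin.cons true τ) + f (Fin.cons false τ)) := by
  rw [← (Fin.consEquiv (fun _ => Bool)).sum_comp, Fintype.sum_prod_type]
  simp [Finset.sum_add_distrib, Fin.consEquiv]

lemma bddAbove_range {ι : Type*} [Finite ι] (f : ι → ℝ) : BddAbove (Set.range f) :=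
  (Set.finite_range f).bddAbove

/-- The cross terms with `x 0` cancel between the two values of the first sign; this is the
parallelogram law. -/
lemma sum_norm_sq_signSum {E : Type*} [NormedAddCommGroup E] [InnerProductSpace ℝ E] {n : ℕ}
    (x : Fin n → E) :
    ∑ σ : Fin n → Bool, ‖∑ i, sgn (σ i) • x i‖ ^ 2 = 2 ^ n * ∑ i, ‖x i‖ ^ 2 := by
  induction n with
  | zero => simp
  | succ n ih =>
    have key : ∀ v : E, ‖(1 : ℝ) • x 0 + v‖ ^ 2 + ‖(-1 : ℝ) • x 0 + v‖ ^ 2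
        = 2 * ‖x 0‖ ^ 2 + 2 * ‖v‖ ^ 2 := fun v => by
      have := parallelogram_law_with_norm ℝ v (x 0)
      rw [one_smul, neg_one_smul, add_comm (x 0), neg_add_eq_sub]
      nlinarith
    rw [sum_cons]
    simp only [Fin.sum_univ_succ, Fin.cons_zero, Fin.cons_succ, sgn_true, sgn_false, key]
    have h := ih (fun i => x i.succ)
    simp only [Finset.sum_add_distrib, ← Finset.mul_sum, h]
    simp
    ring

lemma sum_norm_signSum_le {E : Type*} [NormedAddCommGroup E] [InnerProductSpace ℝ E] {n : ℕ}
    (x : Fin n → E) (hx : ∀ i, ‖x i‖ ≤ 1) :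
    ∑ σ : Fin n → Bool, ‖∑ i, sgn (σ i) • x i‖ ≤ 2 ^ n * √n := by
  have h1 := sq_sum_le_card_mul_sum_sq (s := (Finset.univ : Finset (Fin n → Bool)))
    (f := fun σ => ‖∑ i, sgn (σ i) • x i‖)
  rw [sum_norm_sq_signSum] at h1
  have h2 : ∑ i, ‖x i‖ ^ 2 ≤ n := by
    calc ∑ i, ‖x i‖ ^ 2 ≤ ∑ _i : Fin n, (1 : ℝ) :=
          Finset.sum_le_sum fun i _ => pow_le_one₀ (norm_nonneg _) (hx i)
      _ = n := by simp
  refine abs_le_of_sq_le_sq' ?_ (by positivity) |>.2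
  refine h1.trans ?_
  rw [mul_pow, Real.sq_sqrt (by positivity)]
  simp only [Finset.card_univ, Fintype.card_pi, Fintype.card_bool, Finset.prod_const,
    Fintype.card_fin, Nat.cast_pow, Nat.cast_ofNat]
  nlinarith [mul_le_mul_of_nonneg_left h2 (by positivity : (0:ℝ) ≤ 2 ^ n * 2 ^ n)]

lemma exp_add_exp_le {u v : ℝ} (h : |u - v| ≤ 2) (c : ℝ) :
    Real.exp (c * u) + Real.exp (c * v) ≤ 2 * Real.exp (c * ((u + v) / 2) + c ^ 2 / 2) := by
  have h1 : Real.exp (c * u) + Real.exp (c * v)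
      = 2 * (Real.exp (c * ((u + v) / 2)) * Real.cosh (c * ((u - v) / 2))) := by
    rw [Real.cosh_eq]
    rw [show c * u = c * ((u + v) / 2) + c * ((u - v) / 2) by ring,
      show c * v = c * ((u + v) / 2) + -(c * ((u - v) / 2)) by ring, Real.exp_add, Real.exp_add]
    ring
  rw [h1, Real.exp_add]
  have h2 : (c * ((u - v) / 2)) ^ 2 / 2 ≤ c ^ 2 / 2 := by
    have : (u - v) ^ 2 ≤ 2 ^ 2 := sq_le_sq' (by linarith [(abs_le.1 h).1]) (abs_le.1 h).2
    nlinarith [sq_nonneg c]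
  gcongr
  exact (Real.cosh_le_exp_half_sq _).trans (Real.exp_le_exp.2 h2)

/-- The bounded differences inequality for functions on the cube. -/
theorem sum_exp_le_of_bounded_differences {n : ℕ} (f : (Fin n → Bool) → ℝ)
    (hf : ∀ σ i b, |f (Function.update σ i b) - f σ| ≤ 2) (c : ℝ) :
    ∑ σ, Real.exp (c * f σ) ≤
      2 ^ n * Real.exp (c * ((∑ σ, f σ) / 2 ^ n) + c ^ 2 * n / 2) := by
  induction n with
  | zero => simp
  | succ n ih =>
    -- Averaging out the first sign keeps the mean and the bounded differences, so the induction
    -- takes the place of a martingale argument.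
    set g : (Fin n → Bool) → ℝ := fun τ => (f (Fin.cons true τ) + f (Fin.cons false τ)) / 2
      with hg
    have hgd : ∀ σ i b, |g (Function.update σ i b) - g σ| ≤ 2 := fun σ i b => by
      have h1 := hf (Fin.cons true σ) i.succ b
      have h2 := hf (Fin.cons false σ) i.succ b
      rw [← Fin.cons_update] at h1 h2
      rw [abs_le] at *
      simp only [hg]
      constructor <;> linarith [h1.1, h2.1, h1.2, h2.2]
    have hsum : (∑ σ, f σ) / 2 ^ (n + 1) = (∑ τ, g τ) / 2 ^ n := by
      rw [sum_cons, hg, ← Finset.sum_div, pow_succ]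
      field_simp
    rw [sum_cons, hsum]
    calc ∑ τ : Fin n → Bool, (Real.exp (c * f (Fin.cons true τ))
            + Real.exp (c * f (Fin.cons false τ)))
        ≤ ∑ τ : Fin n → Bool, 2 * Real.exp (c ^ 2 / 2) * Real.exp (c * g τ) := by
          refine Finset.sum_le_sum fun τ _ => ?_
          have h1 := hf (Fin.cons false τ) 0 true
          rw [Fin.update_cons_zero] at h1
          refine (exp_add_exp_le h1 c).trans (le_of_eq ?_)
          rw [Real.exp_add]
          ring
      _ ≤ 2 * Real.exp (c ^ 2 / 2) *
            (2 ^ n * Real.exp (c * ((∑ σ, g σ) / 2 ^ n) + c ^ 2 * n / 2)) := by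
          rw [← Finset.mul_sum]
          exact mul_le_mul_of_nonneg_left (ih g hgd) (by positivity)
      _ = _ := by
          rw [show c * ((∑ σ, g σ) / 2 ^ n) + c ^ 2 * ((n + 1 : ℕ) : ℝ) / 2
            = c ^ 2 / 2 + (c * ((∑ σ, g σ) / 2 ^ n) + c ^ 2 * n / 2) by push_cast; ring,
            Real.exp_add (c ^ 2 / 2)]
          ring

/-- A maximal inequality for finitely many functions on the cube with bounded differences. -/
theorem sum_iSup_le_of_bounded_differences {n : ℕ} {κ : Type*} [Fintype κ] [Nonempty κ]
    (Y : κ → (Fin n → Bool) → ℝ)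
    (hY : ∀ v σ i b, |Y v (Function.update σ i b) - Y v σ| ≤ 2) {μ : ℝ}
    (hμ : ∀ v, ∑ σ, Y v σ ≤ 2 ^ n * μ) {c : ℝ} (hc : 0 < c) :
    ∑ σ, ⨆ v, Y v σ ≤ 2 ^ n * (μ + Real.log (Fintype.card κ) / c + c * n / 2) := by
  -- `K` normalizes the exponential sum: `∑ v, exp (c * Y v - K)` has mean at most `1`. With `x + 1
  -- ≤ exp x` this bounds the mean of the maximum without Jensen's inequality.
  set K : ℝ := Real.log (Fintype.card κ) + (c * μ + c ^ 2 * n / 2) with hK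
  have hcard : (0 : ℝ) < Fintype.card κ := by exact_mod_cast Fintype.card_pos
  have h1 : ∀ σ, c * (⨆ v, Y v σ) - K + 1 ≤ ∑ v, Real.exp (c * Y v σ) * Real.exp (-K) := by
    intro σ
    obtain ⟨v, hv⟩ := exists_eq_ciSup_of_finite (f := fun v => Y v σ)
    rw [← hv]
    refine (Real.add_one_le_exp _).trans ?_
    rw [sub_eq_add_neg, Real.exp_add]
    exact Finset.single_le_sum (f := fun v => Real.exp (c * Y v σ) * Real.exp (-K))
      (fun v _ => by positivity) (Finset.mem_univ v)
  have h2 : ∑ σ : Fin n → Bool, (c * (⨆ v, Y v σ) - K + 1) ≤ 2 ^ n := by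
    refine (Finset.sum_le_sum fun σ _ => h1 σ).trans ?_
    rw [Finset.sum_comm]
    calc ∑ v, ∑ σ, Real.exp (c * Y v σ) * Real.exp (-K)
        ≤ ∑ v : κ, 2 ^ n * Real.exp (c * μ + c ^ 2 * n / 2) * Real.exp (-K) := by
          refine Finset.sum_le_sum fun v _ => ?_
          rw [← Finset.sum_mul]
          gcongr
          refine (sum_exp_le_of_bounded_differences (Y v) (hY v) c).trans ?_
          gcongr
          rw [div_le_iff₀ (by positivity)]
          linarith [hμ v]
      _ = 2 ^ n := by
          rw [Finset.sum_const, Finset.card_univ, nsmul_eq_mul, mul_assoc, ← Real.exp_add, hK]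
          rw [show c * μ + c ^ 2 * n / 2 + -(Real.log (Fintype.card κ) + (c * μ + c ^ 2 * n / 2))
            = -Real.log (Fintype.card κ) by ring, Real.exp_neg, Real.exp_log hcard]
          field_simp
  simp only [Finset.sum_add_distrib, Finset.sum_sub_distrib, ← Finset.mul_sum,
    Finset.sum_const, Finset.card_univ, Fintype.card_pi, Fintype.card_bool, Finset.prod_const,
    Fintype.card_fin, nsmul_eq_mul, Nat.cast_pow, Nat.cast_ofNat] at h2
  have h3 : c * ∑ σ, ⨆ v, Y v σ ≤ 2 ^ n * K := by linarith
  rw [← le_div_iff₀' hc] at h3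
  refine h3.trans (le_of_eq ?_)
  rw [hK]
  field_simp
  ring

/-- Take maximizers `s`, `t` of the two suprema on the left. The sign of `ψ s - ψ t` decides which
of them to insert into which supremum on the right. This is the contraction principle for a single
sign. -/
lemma iSup_add_iSup_sub_le {ι : Type*} [Finite ι] [Nonempty ι] (g φ ψ : ι → ℝ)
    (h : ∀ s t, |φ s - φ t| ≤ |ψ s - ψ t|) :
    (⨆ t, (g t + φ t)) + (⨆ t, (g t - φ t)) ≤ (⨆ t, (g t + ψ t)) + ⨆ t, (g t - ψ t) := by
  obtain ⟨s, hs⟩ := exists_eq_ciSup_of_finite (f := fun t => g t + φ t)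
  obtain ⟨t, ht⟩ := exists_eq_ciSup_of_finite (f := fun t => g t - φ t)
  rw [← hs, ← ht]
  have h1 := fun t => le_ciSup (bddAbove_range fun t => g t + ψ t) t
  have h2 := fun t => le_ciSup (bddAbove_range fun t => g t - ψ t) t
  have h3 := (le_abs_self _).trans (h s t)
  rcases abs_cases (ψ s - ψ t) with h4 | h4
  · linarith [h1 s, h2 t]
  · linarith [h1 t, h2 s]

/-- The contraction principle for Rademacher sums. -/
theorem sum_iSup_contraction {ι : Type*} [Finite ι] [Nonempty ι] {n : ℕ} (g : ι → ℝ)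
    (φ ψ : Fin n → ι → ℝ) (h : ∀ i s t, |φ i s - φ i t| ≤ |ψ i s - ψ i t|) :
    ∑ σ : Fin n → Bool, ⨆ t, (g t + ∑ i, sgn (σ i) * φ i t) ≤
      ∑ σ : Fin n → Bool, ⨆ t, (g t + ∑ i, sgn (σ i) * ψ i t) := by
  induction n generalizing g with
  | zero => simp
  | succ n ih =>
    rw [sum_cons, sum_cons]
    simp only [Fin.sum_univ_succ, Fin.cons_zero, Fin.cons_succ, sgn_true, sgn_false]
    -- The term of the first sign is absorbed into the free summand `g`, which is why `g` is
    -- generalized.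
    have hi := fun g => ih g (fun i => φ i.succ) (fun i => ψ i.succ) (fun i => h i.succ)
    have h1 := hi fun t => g t + 1 * φ 0 t
    have h2 := hi fun t => g t + -1 * φ 0 t
    simp only [add_assoc] at h1 h2
    rw [Finset.sum_add_distrib]
    refine (add_le_add h1 h2).trans ?_
    rw [← Finset.sum_add_distrib]
    refine Finset.sum_le_sum fun τ _ => ?_
    have := iSup_add_iSup_sub_le (fun t => g t + ∑ i, sgn (τ i) * ψ i.succ t) (φ 0) (ψ 0) (h 0)
    refine (le_of_eq ?_).trans (this.trans (le_of_eq ?_))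
    all_goals
      congr 1 <;> exact iSup_congr fun t => by ring

lemma abs_iSup_sub_iSup_le {ι : Type*} [Finite ι] [Nonempty ι] (f g : ι → ℝ) {C : ℝ}
    (h : ∀ t, |f t - g t| ≤ C) : |(⨆ t, f t) - ⨆ t, g t| ≤ C := by
  rw [abs_le]
  constructor
  · have : ⨆ t, g t ≤ (⨆ t, f t) + C := ciSup_le fun t => by
      linarith [(abs_le.1 (h t)).1, le_ciSup (bddAbove_range f) t]
    linarith
  · have : ⨆ t, f t ≤ (⨆ t, g t) + C := ciSup_le fun t => by
      linarith [(abs_le.1 (h t)).2, le_ciSup (bddAbove_range g) t]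
    linarith

/-- Rademacher sums of a bounded Lipschitz function of linear functionals of norm at most `B`,
shifted by one of finitely many vectors `v`. -/
theorem sum_iSup_shifted_linear_le {E : Type*} [NormedAddCommGroup E] [InnerProductSpace ℝ E]
    {ι κ : Type*} [Finite ι] [Nonempty ι] [Fintype κ] [Nonempty κ] {n : ℕ}
    {φ : ℝ → ℝ} (hφ : ∀ s, |φ s| ≤ 1) (hφL : ∀ s t, |φ s - φ t| ≤ |s - t|)
    {a : ι → E} {B : ℝ} (ha : ∀ t, ‖a t‖ ≤ B) {x : Fin n → E} (hx : ∀ j, ‖x j‖ ≤ 1)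
    {y : Fin n → ℝ} (hy : ∀ j, |y j| = 1) (v : κ → Fin n → ℝ) (q : ι → κ)
    {f : ι → Fin n → ℝ} {γ : ℝ}
    (hf : ∀ t j, |f t j - φ ((inner ℝ (a t) (x j) + v (q t) j) * y j)| ≤ γ)
    {c : ℝ} (hc : 0 < c) :
    ∑ σ : Fin n → Bool, ⨆ t, ∑ j, sgn (σ j) * f t j ≤
      2 ^ n * (B * √n + Real.log (Fintype.card κ) / c + c * n / 2 + γ * n) := by
  have hB : 0 ≤ B := (norm_nonneg _).trans (ha (Classical.arbitrary ι))
  have hin : ∀ j (s t : ι) w, |φ ((inner ℝ (a s) (x j) + v w j) * y j)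
      - φ ((inner ℝ (a t) (x j) + v w j) * y j)| ≤ |inner ℝ (a s) (x j) - inner ℝ (a t) (x j)| := by
    intro j s t w
    refine (hφL _ _).trans (le_of_eq ?_)
    rw [← sub_mul, abs_mul, hy, mul_one, add_sub_add_right_eq_sub]
  -- The shift `w` no longer depends on `t`. For fixed `w` it cancels in differences, so contraction
  -- removes it together with `φ`.
  set Y : κ → (Fin n → Bool) → ℝ := fun w σ =>
    ⨆ t, ∑ j, sgn (σ j) * φ ((inner ℝ (a t) (x j) + v w j) * y j) with hYdef
  have hYd : ∀ w σ i b, |Y w (Function.update σ i b) - Y w σ| ≤ 2 := by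
    intro w σ i b
    refine abs_iSup_sub_iSup_le _ _ fun t => ?_
    rw [← Finset.sum_sub_distrib, Finset.sum_eq_single i]
    · rw [← sub_mul, abs_mul]
      have h1 : |sgn (Function.update σ i b i) - sgn (σ i)| ≤ 2 := by
        refine (abs_sub _ _).trans ?_
        rw [abs_sgn, abs_sgn]
        norm_num
      nlinarith [hφ ((inner ℝ (a t) (x i) + v w i) * y i),
        abs_nonneg (φ ((inner ℝ (a t) (x i) + v w i) * y i))]
    · intro j _ hj
      rw [Function.update_of_ne hj, sub_self]
    · simp
  have hYm : ∀ w, ∑ σ, Y w σ ≤ 2 ^ n * (B * √n) := by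
    intro w
    have h1 := sum_iSup_contraction (fun _ : ι => (0 : ℝ))
      (fun j t => φ ((inner ℝ (a t) (x j) + v w j) * y j)) (fun j t => inner ℝ (a t) (x j))
      (fun j s t => hin j s t w)
    simp only [zero_add] at h1
    refine h1.trans ?_
    calc ∑ σ : Fin n → Bool, ⨆ t, ∑ j, sgn (σ j) * inner ℝ (a t) (x j)
        ≤ ∑ σ : Fin n → Bool, B * ‖∑ j, sgn (σ j) • x j‖ := by
          refine Finset.sum_le_sum fun σ _ => ciSup_le fun t => ?_
          have : ∑ j, sgn (σ j) * inner ℝ (a t) (x j) = inner ℝ (a t) (∑ j, sgn (σ j) • x j) := by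
            simp [inner_sum, inner_smul_right]
          rw [this]
          exact (real_inner_le_norm _ _).trans (by gcongr; exact ha t)
      _ ≤ B * (2 ^ n * √n) := by
          rw [← Finset.mul_sum]
          exact mul_le_mul_of_nonneg_left (sum_norm_signSum_le x hx) hB
      _ = _ := by ring
  have hfin := sum_iSup_le_of_bounded_differences Y hYd hYm hc
  calc ∑ σ : Fin n → Bool, ⨆ t, ∑ j, sgn (σ j) * f t j
      ≤ ∑ σ : Fin n → Bool, ((⨆ w, Y w σ) + γ * n) := by
        refine Finset.sum_le_sum fun σ _ => ciSup_le fun t => ?_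
        have h1 : ∑ j, sgn (σ j) * f t j ≤
            ∑ j, (sgn (σ j) * φ ((inner ℝ (a t) (x j) + v (q t) j) * y j) + γ) := by
          refine Finset.sum_le_sum fun j _ => ?_
          have h2 : |sgn (σ j) * (f t j - φ ((inner ℝ (a t) (x j) + v (q t) j) * y j))| ≤ γ := by
            rw [abs_mul, abs_sgn, one_mul]
            exact hf t j
          linarith [(abs_le.1 h2).2]
        rw [Finset.sum_add_distrib] at h1
        simp only [Finset.sum_const, Finset.card_univ, Fintype.card_fin, nsmul_eq_mul] at h1
        have h2 := le_ciSup (bddAbove_range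
          fun s => ∑ j, sgn (σ j) * φ ((inner ℝ (a s) (x j) + v (q t) j) * y j)) t
        have h3 := le_ciSup (bddAbove_range fun w => Y w σ) (q t)
        have h4 := h1.trans (add_le_add_left (h2.trans h3) _)
        rwa [mul_comm (n : ℝ) γ] at h4
    _ ≤ _ := by
        rw [Finset.sum_add_distrib]
        simp only [Finset.sum_const, Finset.card_univ, Fintype.card_pi, Fintype.card_bool,
          Finset.prod_const, Fintype.card_fin, nsmul_eq_mul, Nat.cast_pow, Nat.cast_ofNat]
        linarith

end Rademacher

/-! ### Symmetrization and uniform deviations. -/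

namespace Rademacher

section Symmetrization

variable {Z : Type*} [MeasurableSpace Z] {D : Measure Z} [IsProbabilityMeasure D]
  {ι : Type*} [Finite ι] [Nonempty ι] {g : ι → Z → ℝ} {n : ℕ}

lemma abs_iSup_le {f : ι → ℝ} {C : ℝ} (h : ∀ i, |f i| ≤ C) : |⨆ i, f i| ≤ C := by
  simpa using abs_iSup_sub_iSup_le f (fun _ => 0) (by simpa using h)

lemma abs_sum_le_of_abs_le {f : Fin n → ℝ} {C : ℝ} (h : ∀ i, |f i| ≤ C) :
    |∑ i, f i| ≤ n * C := by
  refine (Finset.abs_sum_le_sum_abs _ _).trans ?_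
  refine (Finset.sum_le_sum fun i _ => h i).trans (le_of_eq ?_)
  simp

lemma integrable_of_abs_le {α : Type*} [MeasurableSpace α] {μ : Measure α} [IsFiniteMeasure μ]
    {f : α → ℝ} (hf : Measurable f) {C : ℝ} (h : ∀ x, |f x| ≤ C) : Integrable f μ :=
  Integrable.of_bound hf.aestronglyMeasurable C (Filter.Eventually.of_forall h)

/-- Symmetrization: the expected uniform deviation of empirical sums is at most twice the
Rademacher average. -/
theorem integral_iSup_deviation_le (hg : ∀ i, Measurable (g i)) (hg1 : ∀ i z, |g i z| ≤ 1) {R : ℝ}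
    (hR : ∀ z : Fin n → Z, ∑ σ : Fin n → Bool, ⨆ i, ∑ j, sgn (σ j) * g i (z j) ≤ 2 ^ n * R) :
    ∫ S, ⨆ i, ∑ j, (∫ z, g i z ∂D - g i (S j)) ∂(Measure.pi fun _ : Fin n => D) ≤ 2 * R := by
  set P : Measure (Fin n → Z) := Measure.pi fun _ : Fin n => D with hP
  set F : (Fin n → Z) × (Fin n → Z) → ℝ := fun w => ⨆ i, ∑ j, (g i (w.2 j) - g i (w.1 j)) with hF
  have hgi : ∀ i, Integrable (g i) D := fun i => integrable_of_abs_le (hg i) (hg1 i)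
  have hdiff : ∀ i z z', |g i z - g i z'| ≤ 2 := fun i z z' => by
    refine (abs_sub _ _).trans ?_
    linarith [hg1 i z, hg1 i z']
  have hFm : Measurable F := Measurable.iSup fun i => by fun_prop
  have hFb : ∀ w, |F w| ≤ n * 2 := fun w =>
    abs_iSup_le fun i => abs_sum_le_of_abs_le fun j => hdiff _ _ _
  have hFi : Integrable F (P.prod P) := integrable_of_abs_le hFm hFb
  -- Ghost sample: the expectation is that of a second sample, and a supremum of integrals is at
  -- most the integral of the supremum.
  have hstep : ∫ S, ⨆ i, ∑ j, (∫ z, g i z ∂D - g i (S j)) ∂P ≤ ∫ w, F w ∂(P.prod P) := by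
    rw [integral_prod _ hFi]
    refine integral_mono ?_ hFi.integral_prod_left fun S => ?_
    · refine integrable_of_abs_le (C := n * 2) (Measurable.iSup fun i => by fun_prop) fun S =>
        abs_iSup_le fun i => abs_sum_le_of_abs_le fun j => ?_
      have h1 : |∫ z, g i z ∂D| ≤ 1 := by
        simpa using norm_integral_le_of_norm_le_const (μ := D) (f := g i) (C := 1)
          (Filter.Eventually.of_forall (hg1 i))
      refine (abs_sub _ _).trans ?_
      linarith [hg1 i (S j)]
    · refine ciSup_le fun i => ?_
      have h1 : ∀ j : Fin n, Integrable (fun S' : Fin n → Z => g i (S' j) - g i (S j)) P := fun j =>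
        integrable_of_abs_le (by fun_prop) fun S' => hdiff _ _ _
      have h2 : ∑ j, (∫ z, g i z ∂D - g i (S j)) = ∫ S', ∑ j, (g i (S' j) - g i (S j)) ∂P := by
        rw [integral_finsetSum _ fun j _ => h1 j]
        refine Finset.sum_congr rfl fun j _ => ?_
        rw [integral_sub (integrable_of_abs_le (by fun_prop) fun S' => hg1 i _)
          (integrable_const _), hP, integral_comp_eval (hg i).aestronglyMeasurable]
        simp
      rw [h2]
      refine integral_mono (integrable_finsetSum _ fun j _ => h1 j)
        (integrable_of_abs_le (by fun_prop) fun S' => hFb (S, S')) fun S' => ?_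
      exact le_ciSup (bddAbove_range fun i => ∑ j, (g i (S' j) - g i (S j))) i
  refine hstep.trans ?_
  set ν : Measure (Fin n → Z × Z) := Measure.pi fun _ : Fin n => D.prod D with hν
  have he := measurePreserving_arrowProdEquivProdArrow Z Z (Fin n) (fun _ => D) (fun _ => D)
  set G : (Fin n → Bool) → (Fin n → Z × Z) → ℝ := fun σ w =>
    ⨆ i, ∑ j, sgn (σ j) * (g i (w j).2 - g i (w j).1) with hG
  have hGm : ∀ σ, Measurable (G σ) := fun σ => Measurable.iSup fun i => by fun_prop
  have hGb : ∀ σ w, |G σ w| ≤ n * 2 := fun σ w =>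
    abs_iSup_le fun i => abs_sum_le_of_abs_le fun j => by
      rw [abs_mul, abs_sgn, one_mul]
      exact hdiff _ _ _
  have hGi : ∀ σ, Integrable (G σ) ν := fun σ => integrable_of_abs_le (hGm σ) (hGb σ)
  -- Exchanging the two samples at the indices with sign `-1` preserves the law, so the signs can be
  -- inserted for free.
  have hswap : ∀ σ, ∫ w, F w ∂(P.prod P) = ∫ w, G σ w ∂ν := by
    intro σ
    have hs : MeasurePreserving (fun (w : Fin n → Z × Z) j => (if σ j then id else Prod.swap) (w j))
        ν ν := measurePreserving_pi _ _ fun j => by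
      by_cases h : σ j
      · simpa [h] using MeasurePreserving.id _
      · simpa [h] using Measure.measurePreserving_swap
    have h1 := he.comp hs
    have h2 : P.prod P = ν.map (MeasurableEquiv.arrowProdEquivProdArrow Z Z (Fin n) ∘
        fun (w : Fin n → Z × Z) j => (if σ j then id else Prod.swap) (w j)) := h1.map_eq.symm
    rw [h2, integral_map h1.measurable.aemeasurable hFm.aestronglyMeasurable]
    refine integral_congr_ae (Filter.Eventually.of_forall fun w => ?_)
    simp only [hF, hG]
    refine iSup_congr fun i => Finset.sum_congr rfl fun j _ => ?_
    cases h : σ j <;> simp [MeasurableEquiv.arrowProdEquivProdArrow, Equiv.arrowProdEquivProdArrow, h]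
  have hsum : 2 ^ n * ∫ w, F w ∂(P.prod P) = ∫ w, ∑ σ, G σ w ∂ν := by
    rw [integral_finsetSum _ fun σ _ => hGi σ, ← Finset.sum_congr rfl fun σ _ => hswap σ]
    simp
  have hpt : ∀ w, ∑ σ, G σ w ≤ 2 ^ n * (2 * R) := by
    intro w
    have h1 : ∀ σ : Fin n → Bool, G σ w ≤ (⨆ i, ∑ j, sgn (σ j) * g i (w j).2) +
        ⨆ i, ∑ j, sgn (!σ j) * g i (w j).1 := fun σ => ciSup_le fun i => by
      have h2 := le_ciSup (bddAbove_range fun i => ∑ j, sgn (σ j) * g i (w j).2) i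
      have h3 := le_ciSup (bddAbove_range fun i => ∑ j, sgn (!σ j) * g i (w j).1) i
      refine le_trans (le_of_eq ?_) (add_le_add h2 h3)
      rw [← Finset.sum_add_distrib]
      exact Finset.sum_congr rfl fun j _ => by rw [sgn_not]; ring
    refine (Finset.sum_le_sum fun σ _ => h1 σ).trans ?_
    rw [Finset.sum_add_distrib]
    have h2 := hR fun j => (w j).2
    have h3 := hR fun j => (w j).1
    rw [← (Equiv.piCongrRight fun _ : Fin n => Equiv.boolNot).sum_comp] at h3
    simp only [Equiv.piCongrRight_apply, Pi.map_apply, Equiv.boolNot_apply] at h3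
    linarith
  have : 2 ^ n * ∫ w, F w ∂(P.prod P) ≤ 2 ^ n * (2 * R) := by
    rw [hsum]
    refine (integral_mono (integrable_finsetSum _ fun σ _ => hGi σ)
      (integrable_const (2 ^ n * (2 * R))) hpt).trans (le_of_eq ?_)
    simp
  exact le_of_mul_le_mul_left this (by positivity)

/-- One-sided uniform deviations of a finite family, by Markov's inequality. -/
theorem measure_deviation_le (hg : ∀ i, Measurable (g i)) (hg1 : ∀ i z, |g i z| ≤ 1)
    (i₀ : ι) (h₀ : ∀ z, g i₀ z = 0) {R : ℝ}
    (hR : ∀ z : Fin n → Z, ∑ σ : Fin n → Bool, ⨆ i, ∑ j, sgn (σ j) * g i (z j) ≤ 2 ^ n * R)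
    {t : ℝ} (ht : 0 < t) :
    (Measure.pi fun _ : Fin n => D) {S | ∃ i, t < ∑ j, (∫ z, g i z ∂D - g i (S j))} ≤
      ENNReal.ofReal (2 * R / t) := by
  set P : Measure (Fin n → Z) := Measure.pi fun _ : Fin n => D with hP
  set F : (Fin n → Z) → ℝ := fun S => ⨆ i, ∑ j, (∫ z, g i z ∂D - g i (S j)) with hF
  have hFm : Measurable F := Measurable.iSup fun i => by fun_prop
  -- The zero function in the family keeps the supremum nonnegative, as Markov's inequality
  -- requires.
  have hF0 : ∀ S, 0 ≤ F S := fun S => by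
    refine le_trans (le_of_eq ?_)
      (le_ciSup (bddAbove_range fun i => ∑ j, (∫ z, g i z ∂D - g i (S j))) i₀)
    simp [h₀]
  have hFi : Integrable F P := by
    refine integrable_of_abs_le (C := n * 2) hFm fun S =>
        abs_iSup_le fun i => abs_sum_le_of_abs_le fun j => ?_
    have h1 : |∫ z, g i z ∂D| ≤ 1 := by
      simpa using norm_integral_le_of_norm_le_const (μ := D) (f := g i) (C := 1)
        (Filter.Eventually.of_forall (hg1 i))
    refine (abs_sub _ _).trans ?_
    linarith [hg1 i (S j)]
  have h1 := mul_meas_ge_le_integral_of_nonneg (Filter.Eventually.of_forall hF0) hFi t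
  have h2 : ∫ S, F S ∂P ≤ 2 * R := integral_iSup_deviation_le hg hg1 hR
  have h3 : P.real {S | t ≤ F S} ≤ 2 * R / t := by
    rw [le_div_iff₀' ht]
    exact h1.trans h2
  calc P {S | ∃ i, t < ∑ j, (∫ z, g i z ∂D - g i (S j))} ≤ P {S | t ≤ F S} := by
        refine measure_mono fun S hS => ?_
        obtain ⟨i, hi⟩ := hS
        exact hi.le.trans (le_ciSup (bddAbove_range fun i => ∑ j, (∫ z, g i z ∂D - g i (S j))) i)
    _ = ENNReal.ofReal (P.real {S | t ≤ F S}) := (ofReal_measureReal).symm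
    _ ≤ _ := ENNReal.ofReal_le_ofReal h3

/-- Two-sided uniform deviations of a finite family. -/
theorem measure_abs_deviation_le (hg : ∀ i, Measurable (g i)) (hg1 : ∀ i z, |g i z| ≤ 1)
    (i₀ : ι) (h₀ : ∀ z, g i₀ z = 0) {R : ℝ} (hR0 : 0 ≤ R)
    (hR : ∀ z : Fin n → Z, ∑ σ : Fin n → Bool, ⨆ i, ∑ j, sgn (σ j) * g i (z j) ≤ 2 ^ n * R)
    {t : ℝ} (ht : 0 < t) :
    (Measure.pi fun _ : Fin n => D) {S | ∃ i, t < |∑ j, (∫ z, g i z ∂D - g i (S j))|} ≤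
      ENNReal.ofReal (4 * R / t) := by
  have h1 := measure_deviation_le (D := D) hg hg1 i₀ h₀ hR ht
  have hR' : ∀ z : Fin n → Z,
      ∑ σ : Fin n → Bool, ⨆ i, ∑ j, sgn (σ j) * (-g i (z j)) ≤ 2 ^ n * R := fun z => by
    have h3 := hR z
    rw [← (Equiv.piCongrRight fun _ : Fin n => Equiv.boolNot).sum_comp] at h3
    simp only [Equiv.piCongrRight_apply, Pi.map_apply, Equiv.boolNot_apply, sgn_not] at h3
    simpa using h3
  have h2 := measure_deviation_le (D := D) (g := fun i z => -g i z) (fun i => (hg i).neg)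
    (fun i z => by simpa using hg1 i z) i₀ (by simpa using h₀) hR' ht
  refine (measure_mono ?_).trans ((measure_union_le _ _).trans ((add_le_add h1 h2).trans ?_))
  · rintro S ⟨i, hi⟩
    rcases lt_abs.1 hi with h | h
    · exact Or.inl ⟨i, h⟩
    · refine Or.inr ⟨i, h.trans_le (le_of_eq ?_)⟩
      rw [← Finset.sum_neg_distrib]
      refine Finset.sum_congr rfl fun j _ => ?_
      rw [integral_neg]
      ring
  · rw [← ENNReal.ofReal_add (by positivity) (by positivity)]
    exact ENNReal.ofReal_le_ofReal (le_of_eq (by ring))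

end Symmetrization

/-- Two-sided uniform deviations of a sequence of functions that starts with `0`, each initial
segment of which has Rademacher averages at most `R`. -/
theorem measure_abs_deviation_nat_le {Z : Type*} [MeasurableSpace Z] {D : Measure Z}
    [IsProbabilityMeasure D] {n : ℕ} {g : ℕ → Z → ℝ} (hg : ∀ i, Measurable (g i))
    (hg1 : ∀ i z, |g i z| ≤ 1) (h₀ : ∀ z, g 0 z = 0) {R : ℝ} (hR0 : 0 ≤ R)
    (hR : ∀ (N : ℕ) (z : Fin n → Z),
      ∑ σ : Fin n → Bool, ⨆ i : Fin (N + 1), ∑ j, sgn (σ j) * g i (z j) ≤ 2 ^ n * R)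
    {t : ℝ} (ht : 0 < t) :
    (Measure.pi fun _ : Fin n => D) {S | ∃ i, t < |∑ j, (∫ z, g i z ∂D - g i (S j))|} ≤
      ENNReal.ofReal (4 * R / t) := by
  set A : ℕ → Set (Fin n → Z) := fun N =>
    {S | ∃ i : Fin (N + 1), t < |∑ j, (∫ z, g i z ∂D - g i (S j))|} with hA
  have hmono : Monotone A := by
    rintro N M hNM S ⟨i, hi⟩
    exact ⟨⟨i, by omega⟩, hi⟩
  have hU : {S : Fin n → Z | ∃ i, t < |∑ j, (∫ z, g i z ∂D - g i (S j))|} = ⋃ N, A N := by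
    ext S
    simp only [Set.mem_ofPred_eq, Set.mem_iUnion, hA]
    exact ⟨fun ⟨i, hi⟩ => ⟨i, ⟨i, by omega⟩, hi⟩, fun ⟨N, i, hi⟩ => ⟨i, hi⟩⟩
  -- Continuity from below: the bound does not depend on `N`, so it passes to the increasing union.
  rw [hU, hmono.measure_iUnion]
  exact iSup_le fun N => measure_abs_deviation_le (g := fun (i : Fin (N + 1)) => g i)
    (fun i => hg i) (fun i => hg1 i) 0 h₀ hR0 (hR N) ht

end Rademacher

/-! ### Counting the quantized values of sparse functionals. -/

namespace Rademacher

lemma sum_choose_le (m k : ℕ) : ∑ i ∈ Finset.Iic k, m.choose i ≤ (m + 1) ^ k := by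
  rw [← Nat.range_succ_eq_Iic]
  induction k with
  | zero => simp
  | succ k ih =>
    rw [Finset.sum_range_succ, pow_succ (m + 1), mul_add, mul_one, add_comm]
    refine add_le_add ((Nat.choose_le_pow m (k + 1)).trans ?_) ih
    rw [pow_succ]
    gcongr
    omega

open Classical in
/-- The traces of affine halfspaces with fixed thresholds on a finite set of points of `ℝ ^ k`. -/
noncomputable def halfspaceTraces {α : Type*} [Fintype α] {k : ℕ} (p : α → Fin k → ℝ) (t : α → ℝ) :
    Finset (Finset α) :=
  {A | ∃ u : Fin k → ℝ, ∀ a, a ∈ A ↔ t a ≤ ∑ l, u l * p a l}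

-- More than `k` points of `ℝ^k` satisfy a linear relation with coefficients `c`, so `∑ c a * (⟨u, p
-- a⟩ - t a)` does not depend on `u`. Shattering supplies a `u` selecting exactly `c > 0`, making
-- all terms nonnegative, and a `w` selecting exactly `c < 0`, making all terms nonpositive. A
-- nonzero coefficient makes one of the two sums strict, a contradiction.
open Classical in
lemma card_le_of_shatters_halfspaceTraces {α : Type*} [Fintype α] {k : ℕ}
    {p : α → Fin k → ℝ} {t : α → ℝ} {s : Finset α} (hs : (halfspaceTraces p t).Shatters s) :
    s.card ≤ k := by
  by_contra! hcard
  have hdep : ¬ LinearIndependent ℝ fun a : s => p a := fun h => by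
    have := h.fintype_card_le_finrank
    simp at this
    omega
  obtain ⟨c, hc, z, hz⟩ := Fintype.not_linearIndependent_iff.1 hdep
  have hsum : ∀ u : Fin k → ℝ,
      ∑ a : s, c a * ((∑ l, u l * p a l) - t a) = -∑ a : s, c a * t a := by
    intro u
    have h1 : ∑ a : s, c a * (∑ l, u l * p a l) = 0 := by
      simp_rw [Finset.mul_sum]
      rw [Finset.sum_comm]
      refine Finset.sum_eq_zero fun l _ => ?_
      have := congrFun hc l
      simp only [Finset.sum_apply, Pi.smul_apply, smul_eq_mul, Pi.zero_apply] at this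
      calc ∑ a : s, c a * (u l * p a l) = u l * ∑ a : s, c a * p a l := by
            rw [Finset.mul_sum]
            exact Finset.sum_congr rfl fun a _ => by ring
        _ = 0 := by rw [this, mul_zero]
    simp_rw [mul_sub]
    rw [Finset.sum_sub_distrib, h1, zero_sub]
  have hpat : ∀ Q : s → Prop, ∃ u : Fin k → ℝ, ∀ a : s, Q a ↔ t a ≤ ∑ l, u l * p a l := by
    intro Q
    have hsub : (Finset.univ.filter Q).map (Function.Embedding.subtype _) ⊆ s := by
      intro a ha
      simp only [Finset.mem_map, Function.Embedding.subtype_apply] at ha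
      obtain ⟨b, _, rfl⟩ := ha
      exact b.2
    obtain ⟨A, hA, hAs⟩ := hs hsub
    obtain ⟨u, hu⟩ := (Finset.mem_filter.1 hA).2
    refine ⟨u, fun a => ?_⟩
    rw [← hu]
    have := Finset.ext_iff.1 hAs a
    simpa using this.symm
  obtain ⟨u, hu⟩ := hpat fun a => 0 < c a
  obtain ⟨w, hw⟩ := hpat fun a => c a < 0
  have hu0 : ∀ a : s, 0 ≤ c a * ((∑ l, u l * p a l) - t a) := fun a => by
    by_cases h : 0 < c a
    · exact mul_nonneg h.le (sub_nonneg.2 ((hu a).1 h))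
    · exact mul_nonneg_of_nonpos_of_nonpos (not_lt.1 h)
        (sub_nonpos.2 (not_le.1 (mt (hu a).2 h)).le)
  have hw0 : ∀ a : s, c a * ((∑ l, w l * p a l) - t a) ≤ 0 := fun a => by
    by_cases h : c a < 0
    · exact mul_nonpos_of_nonpos_of_nonneg h.le (sub_nonneg.2 ((hw a).1 h))
    · exact mul_nonpos_of_nonneg_of_nonpos (not_lt.1 h)
        (sub_nonpos.2 (not_le.1 (mt (hw a).2 h)).le)
  have h1 := Finset.sum_nonneg fun a (_ : a ∈ Finset.univ) => hu0 a
  have h2 := Finset.sum_nonpos fun a (_ : a ∈ Finset.univ) => hw0 a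
  rcases lt_or_gt_of_ne hz with h | h
  · have h3 : 0 < c z * ((∑ l, u l * p z l) - t z) :=
      mul_pos_of_neg_of_neg h (sub_neg.2 (not_le.1 (mt (hu z).2 h.not_gt)))
    have h4 := Finset.single_le_sum (fun a _ => hu0 a) (Finset.mem_univ z)
    rw [hsum] at h1 h2 h4
    linarith
  · have h3 : c z * ((∑ l, w l * p z l) - t z) < 0 :=
      mul_neg_of_pos_of_neg h (sub_neg.2 (not_le.1 (mt (hw z).2 h.not_gt)))
    have h4 := Finset.single_le_sum (f := fun a : s => -(c a * ((∑ l, w l * p a l) - t a)))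
      (fun a _ => neg_nonneg.2 (hw0 a)) (Finset.mem_univ z)
    rw [Finset.sum_neg_distrib] at h4
    rw [hsum] at h1 h2 h4
    linarith

lemma card_halfspaceTraces_le {α : Type*} [Fintype α] {k : ℕ} (p : α → Fin k → ℝ) (t : α → ℝ) :
    (halfspaceTraces p t).card ≤ (Fintype.card α + 1) ^ k := by
  classical
  refine (Finset.card_le_card_shatterer _).trans (Finset.card_shatterer_le_sum_vcDim.trans ?_)
  refine (Finset.sum_le_sum_of_subset ?_).trans (sum_choose_le _ k)
  refine Finset.Iic_subset_Iic.2 (Finset.sup_le fun s hs => ?_)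
  exact card_le_of_shatters_halfspaceTraces (Finset.mem_shatterer.1 hs)

/-- The index of the cell of a grid with mesh `γ`, starting at `-T`, that contains `s`. -/
noncomputable def quantize (M : ℕ) (T γ s : ℝ) : Fin (M + 1) :=
  ⟨min M ⌊(s + T) / γ⌋₊, by omega⟩

lemma lt_quantize_iff {M : ℕ} {T γ s : ℝ} (hγ : 0 < γ) (j : Fin M) :
    (j : ℕ) < quantize M T γ s ↔ (j + 1 : ℕ) * γ - T ≤ s := by
  have : (j : ℕ) < quantize M T γ s ↔ (j : ℕ) + 1 ≤ ⌊(s + T) / γ⌋₊ := by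
    simp only [quantize, lt_min_iff, j.2, true_and, Nat.lt_iff_add_one_le]
  rw [this, Nat.le_floor_iff' (by omega), le_div_iff₀ hγ]
  constructor <;> intro h <;> linarith

open Classical in
/-- The quantized values on `x` of the linear functionals with at most `k` nonzero coordinates. -/
noncomputable def sparseCells {n d : ℕ} (k M : ℕ) (T γ : ℝ) (x : Fin n → Fin d → ℝ) :
    Finset (Fin n → Fin (M + 1)) :=
  {v | ∃ (J : Fin k → Fin d) (u : Fin k → ℝ), ∀ i, v i = quantize M T γ (∑ l, u l * x i (J l))}

lemma mem_sparseCells {n d k M : ℕ} {T γ : ℝ} {x : Fin n → Fin d → ℝ}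
    (J : Fin k → Fin d) (u : Fin k → ℝ) :
    (fun i => quantize M T γ (∑ l, u l * x i (J l))) ∈ sparseCells k M T γ x := by
  classical exact Finset.mem_filter.2 ⟨Finset.mem_univ _, J, u, fun _ => rfl⟩

lemma card_sparseCells_le {n d : ℕ} (k M : ℕ) {T γ : ℝ} (hγ : 0 < γ) (x : Fin n → Fin d → ℝ) :
    (sparseCells k M T γ x).card ≤ (d * (n * M + 1)) ^ k := by
  classical
  set W : (Fin k → Fin d) → Finset (Fin n → Fin (M + 1)) := fun J =>
    {v | ∃ u : Fin k → ℝ, ∀ i, v i = quantize M T γ (∑ l, u l * x i (J l))} with hW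
  have hWc : ∀ J, (W J).card ≤ (n * M + 1) ^ k := by
    intro J
    -- For a fixed support tuple, a quantized vector is determined by comparing each of the `n`
    -- values with the `M` grid thresholds, that is, by a halfspace trace on `n * M` points of
    -- `ℝ^k`.
    have h1 := card_halfspaceTraces_le (α := Fin n × Fin M) (fun a l => x a.1 (J l))
      (fun a => (a.2 + 1 : ℕ) * γ - T)
    rw [Fintype.card_prod, Fintype.card_fin, Fintype.card_fin] at h1
    refine le_trans ?_ h1
    refine Finset.card_le_card_of_injOn
      (fun v => Finset.univ.filter fun a : Fin n × Fin M => (a.2 : ℕ) < v a.1) ?_ ?_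
    · intro v hv
      obtain ⟨u, hu⟩ := (Finset.mem_filter.1 hv).2
      refine Finset.mem_filter.2 ⟨Finset.mem_univ _, u, fun a => ?_⟩
      rw [Finset.mem_filter, hu a.1, lt_quantize_iff hγ]
      simp
    · intro v _ w _ h
      have h2 : ∀ (i : Fin n) (j : Fin M), (j : ℕ) < v i ↔ (j : ℕ) < w i := fun i j => by
        have := Finset.ext_iff.1 h (i, j)
        simpa using this
      funext i
      by_contra hne
      have hne' : (v i : ℕ) ≠ w i := fun h => hne (Fin.ext h)
      rcases lt_or_gt_of_ne hne' with h3 | h3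
      · have := (h2 i ⟨v i, by omega⟩).2 h3
        simp at this
      · have := (h2 i ⟨w i, by omega⟩).1 h3
        simp at this
  have hsub : sparseCells k M T γ x ⊆ Finset.univ.biUnion W := by
    intro v hv
    obtain ⟨J, hJ⟩ := (Finset.mem_filter.1 hv).2
    exact Finset.mem_biUnion.2 ⟨J, Finset.mem_univ _, Finset.mem_filter.2 ⟨Finset.mem_univ _, hJ⟩⟩
  refine (Finset.card_le_card hsub).trans
    ((Finset.card_biUnion_le_card_mul _ _ _ fun J _ => hWc J).trans (le_of_eq ?_))
  simp [mul_pow]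

/-! ### The clipped gain, its quantization error and its Rademacher averages. -/

/-- The gain `max (0, min (s, 1))`, the complement of the ramp loss. -/
noncomputable def clip (s : ℝ) : ℝ := max 0 (min s 1)

lemma clip_nonneg (s : ℝ) : 0 ≤ clip s := le_max_left _ _

lemma clip_le_one (s : ℝ) : clip s ≤ 1 := max_le zero_le_one (min_le_right _ _)

lemma abs_clip_le (s : ℝ) : |clip s| ≤ 1 := by
  rw [abs_of_nonneg (clip_nonneg s)]
  exact clip_le_one s

lemma abs_clip_sub_clip_le (s t : ℝ) : |clip s - clip t| ≤ |s - t| := by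
  refine (abs_max_sub_max_le_max _ _ _ _).trans (max_le (by simp) ?_)
  refine (abs_min_sub_min_le_max _ _ _ _).trans (max_le le_rfl (by simp))

lemma clip_of_nonpos {s : ℝ} (h : s ≤ 0) : clip s = 0 :=
  max_eq_left ((min_le_left _ _).trans h)

lemma clip_of_one_le {s : ℝ} (h : 1 ≤ s) : clip s = 1 := by
  rw [clip, min_eq_right h, max_eq_right zero_le_one]

lemma abs_clip_sub_clip_quantize_le {B γ a s y : ℝ} (hγ : 0 < γ) (ha : |a| ≤ B)
    (hy : y = 1 ∨ y = -1) {M : ℕ} (hM : 2 * (B + 1) / γ ≤ M) :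
    |clip ((a + s) * y) - clip ((a + (quantize M (B + 1) γ s * γ - (B + 1))) * y)| ≤ γ := by
  have hB : 0 ≤ B := (abs_nonneg a).trans ha
  obtain ⟨ha1, ha2⟩ := abs_le.1 ha
  -- Outside the window, `|a + s| ≥ 1`, so the gain is `0` or `1` according to `y` and the side
  -- alone; the extreme cells lose nothing.
  have hsame : ∀ s' : ℝ, (s ≤ -(B + 1) ∧ s' ≤ -(B + 1)) ∨ (B + 1 ≤ s ∧ B + 1 ≤ s') →
      clip ((a + s) * y) = clip ((a + s') * y) := by
    rintro s' (⟨h1, h2⟩ | ⟨h1, h2⟩) <;> rcases hy with rfl | rfl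
    · rw [clip_of_nonpos (by linarith), clip_of_nonpos (by linarith)]
    · rw [clip_of_one_le (by linarith), clip_of_one_le (by linarith)]
    · rw [clip_of_one_le (by linarith), clip_of_one_le (by linarith)]
    · rw [clip_of_nonpos (by linarith), clip_of_nonpos (by linarith)]
  rcases lt_or_ge s (-(B + 1)) with h | h
  · have hq : (quantize M (B + 1) γ s : ℕ) = 0 := by
      simp only [quantize]
      rw [Nat.floor_of_nonpos (div_nonpos_of_nonpos_of_nonneg (by linarith) hγ.le), min_eq_right]
      exact Nat.zero_le _
    rw [hq, hsame ((0 : ℕ) * γ - (B + 1)) (Or.inl ⟨h.le, by simp⟩), sub_self, abs_zero]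
    exact hγ.le
  · have h0 : 0 ≤ (s + (B + 1)) / γ := div_nonneg (by linarith) hγ.le
    rcases le_or_gt ⌊(s + (B + 1)) / γ⌋₊ M with hle | hlt
    · have hq : (quantize M (B + 1) γ s : ℕ) = ⌊(s + (B + 1)) / γ⌋₊ := min_eq_right hle
      rw [hq]
      refine (abs_clip_sub_clip_le _ _).trans ?_
      have h1 := Nat.floor_le h0
      have h2 := Nat.lt_floor_add_one ((s + (B + 1)) / γ)
      rw [le_div_iff₀ hγ] at h1
      rw [div_lt_iff₀ hγ] at h2
      rw [abs_le]
      rcases hy with rfl | rfl <;> constructor <;> linarith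
    · have hq : (quantize M (B + 1) γ s : ℕ) = M := min_eq_left hlt.le
      have h1 : (M : ℝ) ≤ (s + (B + 1)) / γ := (Nat.le_floor_iff h0).1 hlt.le
      rw [le_div_iff₀ hγ] at h1
      rw [div_le_iff₀ hγ] at hM
      rw [hq, hsame (M * γ - (B + 1)) (Or.inr ⟨by linarith, by linarith⟩), sub_self, abs_zero]
      exact hγ.le

/-- A vector with at most `k` nonzero coordinates is supported on the range of a `k`-tuple. -/
lemma exists_sparse_representation {d k : ℕ} (hd : 0 < d) {w : EuclideanSpace ℝ (Fin d)}
    (hw : RulesFirst.zeroNorm w ≤ k) :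
    ∃ (J : Fin k → Fin d) (u : Fin k → ℝ), ∀ x : EuclideanSpace ℝ (Fin d),
      inner ℝ w x = ∑ l, u l * x (J l) := by
  classical
  set s : Set (Fin d) := {j | w j ≠ 0} with hs
  have hcard : Fintype.card s ≤ Fintype.card (Fin k) := by
    rw [Fintype.card_fin, ← Nat.card_eq_fintype_card]
    exact hw
  obtain ⟨e⟩ := Function.Embedding.nonempty_of_card_le hcard
  -- Unused slots of the tuple carry coordinate `0` with weight `0`.
  refine ⟨Function.extend e (fun j => (j : Fin d)) (fun _ => ⟨0, hd⟩),
    Function.extend e (fun j => w j) 0, fun x => ?_⟩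
  rw [← Fintype.sum_of_injective e e.injective (fun j : s => w j * x j)]
  · rw [PiLp.inner_apply]
    simp only [RCLike.inner_apply, conj_trivial]
    have h1 : ∑ j : s, w j * x j = ∑ j ∈ s.toFinset, w j * x j :=
      (Finset.sum_subtype s.toFinset (fun _ => Set.mem_toFinset) (fun j => w j * x j)).symm
    rw [h1]
    rw [Finset.sum_subset (Finset.subset_univ s.toFinset) fun j _ hj => ?_]
    · exact Finset.sum_congr rfl fun j _ => mul_comm _ _
    · have : w j = 0 := by simpa [hs] using hj
      rw [this, zero_mul]
  · intro l hl
    rw [Function.extend_apply' (fun j : s => w j) _ _ hl, Pi.zero_apply, zero_mul]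
  · intro j
    rw [e.injective.extend_apply, e.injective.extend_apply]

/-- Rademacher averages of the gains of finitely many predictors of the class. -/
theorem sum_iSup_gain_le {d k n : ℕ} (hd : 0 < d) {B : ℝ} {ι : Type*} [Finite ι] [Nonempty ι]
    {h : ι → RulesFirst.UnitBall d → ℝ} (hh : ∀ t, h t ∈ RulesFirst.classH20 d k B) (hB : 0 ≤ B)
    {c : ℝ} (hc : 0 < c) {M : ℕ} (hM : 2 * (B + 1) / c ≤ M)
    (z : Fin n → RulesFirst.UnitBall d × RulesFirst.Label) :
    ∑ σ : Fin n → Bool, ⨆ t, ∑ j, sgn (σ j) * clip (h t (z j).1 * (z j).2) ≤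
      2 ^ n * (B * √n + k * Real.log (d * (n * M + 1)) / c + c * n / 2 + c * n) := by
  choose a b ha hb hab using hh
  choose J u hJu using fun t => exists_sparse_representation hd (hb t)
  have ha' : ∀ t, ‖a t‖ ≤ B := fun t => abs_le_of_sq_le_sq' (ha t) hB |>.2
  have hx : ∀ j, ‖((z j).1 : EuclideanSpace ℝ (Fin d))‖ ≤ 1 := fun j =>
    mem_closedBall_zero_iff.1 (z j).1.2
  have hy : ∀ j, ((z j).2 : ℝ) = 1 ∨ ((z j).2 : ℝ) = -1 := fun j =>
    (z j).2.2
  set V := sparseCells k M (B + 1) c (fun j => ⇑((z j).1 : EuclideanSpace ℝ (Fin d))) with hV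
  set q : ι → V := fun t => ⟨fun j => quantize M (B + 1) c (∑ l, u t l *
      ((z j).1 : EuclideanSpace ℝ (Fin d)) (J t l)),
    mem_sparseCells (J t) (u t)⟩ with hq
  have : Nonempty V := ⟨q (Classical.arbitrary ι)⟩
  -- The same `c` serves as grid mesh and as exponential parameter.
  have hmain := sum_iSup_shifted_linear_le (φ := clip) abs_clip_le abs_clip_sub_clip_le ha' hx
    (y := fun j => ((z j).2 : ℝ)) (fun j => by rcases hy j with h | h <;> simp [h])
    (fun (v : V) j => (v.1 j : ℕ) * c - (B + 1)) q
    (f := fun t j => clip (h t (z j).1 * (z j).2)) (γ := c) (fun t j => by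
      simp only [hab t, inner_add_left, hJu t]
      refine abs_clip_sub_clip_quantize_le hc ?_ (hy j) hM
      refine (abs_real_inner_le_norm _ _).trans ?_
      nlinarith [ha' t, hx j, norm_nonneg (a t),
        norm_nonneg ((z j).1 : EuclideanSpace ℝ (Fin d))]) hc
  refine hmain.trans ?_
  have hlog : Real.log (Fintype.card V) ≤ k * Real.log (d * (n * M + 1)) := by
    rw [← Real.log_pow]
    refine Real.log_le_log (by exact_mod_cast Fintype.card_pos) ?_
    rw [Fintype.card_coe]
    exact_mod_cast card_sparseCells_le k M hc _
  gcongr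

end Rademacher

/-! ### From gains to ramp loss, and separability of the class. -/

namespace RulesFirst

open Rademacher

/-- Gains are preferable to losses because the zero predictor has gain identically `0`. -/
lemma rampLoss_eq (s y : ℝ) : rampLoss s y = 1 - clip (s * y) := by
  unfold rampLoss clip
  rcases le_total (s * y) 1 with h | h <;> rcases le_total 0 (s * y) with h' | h'
  · rw [min_eq_left (by linarith), min_eq_left h, max_eq_right (by linarith), max_eq_right h']
  · rw [min_eq_right (by linarith), min_eq_left h, max_eq_right (by linarith), max_eq_left h']
    ring
  · rw [min_eq_left (by linarith), min_eq_right h, max_eq_left (by linarith),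
      max_eq_right zero_le_one]
    ring
  · linarith

lemma continuous_clip : Continuous clip := by
  unfold clip
  fun_prop

lemma measurable_gain {X : Type*} [MeasurableSpace X] {h : X → ℝ} (hh : Measurable h) :
    Measurable fun z : X × Label => clip (h z.1 * z.2) :=
  continuous_clip.measurable.comp
    ((hh.comp measurable_fst).mul (measurable_subtype_coe.comp measurable_snd))

lemma integrable_gain {X : Type*} [MeasurableSpace X] {h : X → ℝ} (hh : Measurable h)
    (D : Measure (X × Label)) [IsProbabilityMeasure D] :
    Integrable (fun z : X × Label => clip (h z.1 * z.2)) D :=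
  integrable_of_abs_le (measurable_gain hh) fun _ => abs_clip_le _

lemma expectedLoss_rampLoss {X : Type*} [MeasurableSpace X] {h : X → ℝ} (hh : Measurable h)
    (D : Measure (X × Label)) [IsProbabilityMeasure D] :
    expectedLoss rampLoss h D = 1 - ∫ z, clip (h z.1 * z.2) ∂D := by
  unfold expectedLoss
  simp_rw [rampLoss_eq]
  rw [integral_sub (integrable_const _) (integrable_gain hh D)]
  simp

lemma abs_label (y : Label) : |(y : ℝ)| = 1 := by
  have h : (y : ℝ) = 1 ∨ (y : ℝ) = -1 := y.2
  rcases h with h | h <;> simp [h]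

lemma expectedLoss_le_add_of_abs_sub_le {X : Type*} [MeasurableSpace X] {h f : X → ℝ} (hh : Measurable h)
    (hf : Measurable f) (D : Measure (X × Label)) [IsProbabilityMeasure D] {η : ℝ}
    (hη : ∀ x, |h x - f x| ≤ η) :
    expectedLoss rampLoss h D ≤ expectedLoss rampLoss f D + η := by
  rw [expectedLoss_rampLoss hh, expectedLoss_rampLoss hf]
  have h1 : ∫ z, clip (f z.1 * z.2) ∂D ≤ ∫ z, (clip (h z.1 * z.2) + η) ∂D := by
    refine integral_mono (integrable_gain hf D)
      ((integrable_gain hh D).add (integrable_const _)) fun z => ?_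
    have h2 := abs_clip_sub_clip_le (h z.1 * z.2) (f z.1 * z.2)
    rw [← sub_mul, abs_mul, abs_label, mul_one] at h2
    show clip (f z.1 * z.2) ≤ clip (h z.1 * z.2) + η
    linarith [(abs_le.1 (h2.trans (hη z.1))).1]
  rw [integral_add (integrable_gain hh D) (integrable_const _)] at h1
  simp at h1
  linarith

lemma measurable_of_mem_classH20 {d k : ℕ} {B : ℝ} {h : UnitBall d → ℝ}
    (hh : h ∈ classH20 d k B) : Measurable h := by
  obtain ⟨wa, wb, -, -, rfl⟩ := hh
  exact ((continuous_const.inner continuous_subtype_val)).measurable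

lemma zero_mem_classH20 (d k : ℕ) (B : ℝ) : (fun _ => 0) ∈ classH20 d k B :=
  ⟨0, 0, by simpa using sq_nonneg B, by simp [zeroNorm], by simp⟩

/-- The class is separable in the uniform norm; the sequence can be taken to start with `0`. -/
lemma exists_dense_seq_classH20 (d k : ℕ) (B : ℝ) :
    ∃ h : ℕ → UnitBall d → ℝ, h 0 = (fun _ => 0) ∧ (∀ i, h i ∈ classH20 d k B) ∧
      ∀ f ∈ classH20 d k B, ∀ η > 0, ∃ i, ∀ x, |h i x - f x| ≤ η := by
  set W : Set (EuclideanSpace ℝ (Fin d)) :=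
    {w | (fun x : UnitBall d => inner ℝ w (x : EuclideanSpace ℝ (Fin d))) ∈ classH20 d k B} with hW
  have h0 : (0 : EuclideanSpace ℝ (Fin d)) ∈ W := by
    simpa [hW] using zero_mem_classH20 d k B
  have : Nonempty W := ⟨⟨0, h0⟩⟩
  refine ⟨fun i => Nat.casesOn i (fun _ => 0) fun i x =>
    inner ℝ (TopologicalSpace.denseSeq W i : EuclideanSpace ℝ (Fin d)) x, rfl, ?_, ?_⟩
  · rintro (_ | i)
    · exact zero_mem_classH20 d k B
    · exact (TopologicalSpace.denseSeq W i).2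
  · rintro f ⟨wa, wb, ha, hb, rfl⟩ η hη
    have hw : wa + wb ∈ W := ⟨wa, wb, ha, hb, rfl⟩
    obtain ⟨i, hi⟩ := (TopologicalSpace.denseRange_denseSeq W).exists_dist_lt ⟨wa + wb, hw⟩ hη
    refine ⟨i + 1, fun x => ?_⟩
    show |inner ℝ (TopologicalSpace.denseSeq W i : EuclideanSpace ℝ (Fin d)) x
      - inner ℝ (wa + wb) (x : EuclideanSpace ℝ (Fin d))| ≤ η
    rw [← inner_sub_left]
    have hx : ‖(x : EuclideanSpace ℝ (Fin d))‖ ≤ 1 := mem_closedBall_zero_iff.1 x.2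
    rw [Subtype.dist_eq, dist_comm, dist_eq_norm] at hi
    refine (abs_real_inner_le_norm _ _).trans ?_
    exact (mul_le_of_le_one_right (norm_nonneg _) hx).trans hi.le

/-! ### Approximate empirical risk minimization. -/

section EmpiricalRisk

lemma exists_approx_maximizer {X : Type*} (h : ℕ → X → ℝ) {ε : ℝ} (hε : 0 < ε) (m : ℕ)
    (S : Fin m → X × Label) :
    ∃ i, ∀ l, ∑ j, clip (h l (S j).1 * (S j).2) ≤
      ∑ j, clip (h i (S j).1 * (S j).2) + ε := by
  have hb : BddAbove (Set.range fun i => ∑ j, clip (h i (S j).1 * (S j).2)) := by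
    refine ⟨m * 1, ?_⟩
    rintro _ ⟨i, rfl⟩
    exact (le_abs_self _).trans (abs_sum_le_of_abs_le fun j => abs_clip_le _)
  obtain ⟨i, hi⟩ := exists_lt_of_lt_ciSup
    (sub_lt_self (⨆ i, ∑ j, clip (h i (S j).1 * (S j).2)) hε)
  exact ⟨i, fun l => by linarith [le_ciSup hb l]⟩

variable {X : Type*} [MeasurableSpace X]

/-- The approximate empirical risk minimizer over a sequence of predictors, with slack `ε / 8`
in the average loss. -/
noncomputable def riskMinimizer (h : ℕ → X → ℝ) (hh : ∀ i, Measurable (h i)) {ε : ℝ}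
    (hε : 0 < ε) : Learner X where
  Seed := Unit
  seedLaw := Measure.dirac ()
  -- The supremum over the sequence need not be attained, hence the slack; `max m 1` keeps it
  -- positive for the empty sample.
  run m S _ := h (exists_approx_maximizer h
    (by positivity : 0 < ε / 8 * max m 1) m S).choose
  measurable_run _ _ _ := hh _

lemma riskMinimizer_succeedsOn {H : Set (X → ℝ)} {h : ℕ → X → ℝ} (hmem : ∀ i, h i ∈ H)
    (hH : ∀ f ∈ H, Measurable f) (h0 : h 0 = fun _ => 0)
    (hdense : ∀ f ∈ H, ∀ η > 0, ∃ i, ∀ x, |h i x - f x| ≤ η) {ε δ : ℝ} (hε : 0 < ε)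
    {m : ℕ} (hm : 0 < m) {R : ℝ} (hR0 : 0 ≤ R)
    (hR : ∀ (N : ℕ) (z : Fin m → X × Label), ∑ σ : Fin m → Bool, ⨆ i : Fin (N + 1),
      ∑ j, sgn (σ j) * clip (h i (z j).1 * (z j).2) ≤ 2 ^ m * R)
    (hRδ : 16 * R ≤ δ * (m * ε)) (D : Measure (X × Label)) [IsProbabilityMeasure D] :
    (riskMinimizer h (fun i => hH _ (hmem i)) hε).SucceedsOn rampLoss H ε δ m D := by
  have hm' : (1 : ℝ) ≤ m := by exact_mod_cast hm
  have hhm := fun i => hH _ (hmem i)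
  set bad : Set (Fin m → X × Label) := {S | ∃ i, m * ε / 4 <
    |∑ j, (∫ z, clip (h i z.1 * z.2) ∂D - clip (h i (S j).1 * (S j).2))|} with hbad
  have hP : (Measure.pi fun _ : Fin m => D) bad ≤ ENNReal.ofReal δ := by
    have ht : 0 < m * ε / 4 := by positivity
    have hdev := measure_abs_deviation_nat_le (D := D)
      (g := fun i (z : X × Label) => clip (h i z.1 * z.2)) (fun i => measurable_gain (hhm i))
      (fun i z => abs_clip_le _) (fun z => by simp [h0, clip]) hR0 hR ht
    refine hdev.trans (ENNReal.ofReal_le_ofReal ?_)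
    rw [div_le_iff₀ ht]
    linarith
  refine (measure_mono (t := bad ×ˢ Set.univ) ?_).trans ?_
  · rintro ⟨S, s⟩ hS
    refine ⟨?_, trivial⟩
    by_contra hgood
    simp only [hbad, Set.mem_ofPred_eq, not_exists, not_lt] at hgood
    rw [Set.mem_ofPred_eq] at hS
    refine absurd hS (not_lt.2 ?_)
    have hspec := (exists_approx_maximizer h
      (by positivity : 0 < ε / 8 * max m 1) m S).choose_spec
    set i := (exists_approx_maximizer h (by positivity : 0 < ε / 8 * max m 1) m S).choose
    rw [max_eq_left (Nat.one_le_iff_ne_zero.2 hm.ne')] at hspec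
    show expectedLoss rampLoss (h i) D ≤ optimalLoss rampLoss H D + ε
    have : Nonempty H := ⟨⟨h 0, hmem 0⟩⟩
    obtain ⟨f, hf⟩ := exists_lt_of_ciInf_lt
      (lt_add_of_pos_right (⨅ f : H, expectedLoss rampLoss (f : X → ℝ) D)
        (by positivity : 0 < ε / 8))
    obtain ⟨l, hl⟩ := hdense f f.2 (ε / 8) (by positivity)
    have h1 := expectedLoss_le_add_of_abs_sub_le (hhm l) (hH _ f.2) D hl
    have h2 := hgood i
    have h3 := hgood l
    simp only [Finset.sum_sub_distrib, Finset.sum_const, Finset.card_univ, Fintype.card_fin,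
      nsmul_eq_mul] at h2 h3
    have h4 := hspec l
    rw [expectedLoss_rampLoss (hhm l)] at h1
    rw [expectedLoss_rampLoss (hhm i)]
    have h5 := (abs_le.1 h2).1
    -- Two deviations of `ε / 4` and the slack `ε / 8` make `5 / 8 * ε`; near-optimality of `f` and
    -- density add `ε / 8` each.
    have h6 := (abs_le.1 h3).2
    have h7 : (m : ℝ) * ∫ z, clip (h l z.1 * z.2) ∂D ≤
        m * (∫ z, clip (h i z.1 * z.2) ∂D + 5 / 8 * ε) := by
      linarith
    have h8 := le_of_mul_le_mul_left h7 (by linarith)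
    unfold optimalLoss
    linarith
  · rw [Measure.prod_prod, measure_univ, mul_one]
    exact hP

end EmpiricalRisk

lemma sampleComplexity_le {X : Type*} [MeasurableSpace X] {loss : ℝ → ℝ → ℝ} {H : Set (X → ℝ)}
    {ε δ : ℝ} (A : Learner X) {n : ℕ} (h : ∀ m : ℕ, n ≤ m → ∀ D : Measure (X × Label),
      IsProbabilityMeasure D → A.SucceedsOn loss H ε δ m D) :
    sampleComplexity loss H ε δ ≤ n :=
  iInf_le_of_le A (iInf₂_le n h)

/-- If `k = 0` and `B ≤ ε` then the zero predictor is `ε`-optimal, without any examples. -/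
lemma sampleComplexity_eq_zero {d : ℕ} {B ε δ : ℝ} (hB : 0 ≤ B) (hBε : B ≤ ε) :
    sampleComplexity rampLoss (classH20 d 0 B) ε δ = 0 := by
  set A : Learner (UnitBall d) :=
    { Seed := Unit
      seedLaw := Measure.dirac ()
      run := fun _ _ _ _ => 0
      measurable_run := fun _ _ _ => measurable_const } with hA
  refine nonpos_iff_eq_zero.1 (sampleComplexity_le (n := 0) A fun m _ D _ => ?_)
  have hempty : {p : (Fin m → UnitBall d × Label) × A.Seed |
      optimalLoss rampLoss (classH20 d 0 B) D + ε <
        expectedLoss rampLoss (A.run m p.1 p.2) D} = ∅ := by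
    refine Set.eq_empty_of_forall_notMem fun p hp => ?_
    rw [Set.mem_ofPred_eq] at hp
    refine absurd hp (not_lt.2 ?_)
    show expectedLoss rampLoss (fun _ => 0) D ≤ _
    have : Nonempty (classH20 d 0 B) := ⟨⟨_, zero_mem_classH20 d 0 B⟩⟩
    rw [← sub_le_iff_le_add]
    refine le_ciInf fun f => ?_
    rw [sub_le_iff_le_add]
    refine expectedLoss_le_add_of_abs_sub_le measurable_const (measurable_of_mem_classH20 f.2) D fun x => ?_
    obtain ⟨f, wa, wb, ha, hb, rfl⟩ := f
    have hwb : wb = 0 := by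
      unfold zeroNorm at hb
      rw [Nat.le_zero, Set.ncard_eq_zero] at hb
      ext j
      by_contra hj
      exact Set.notMem_empty j (hb ▸ hj)
    have hx : ‖(x : EuclideanSpace ℝ (Fin d))‖ ≤ 1 := mem_closedBall_zero_iff.1 x.2
    subst hwb
    show |0 - inner ℝ (wa + 0) (x : EuclideanSpace ℝ (Fin d))| ≤ ε
    rw [zero_sub, abs_neg, add_zero]
    refine (abs_real_inner_le_norm _ _).trans ((mul_le_of_le_one_right (norm_nonneg _) hx).trans ?_)
    exact (abs_le_of_sq_le_sq' ha hB).2.trans hBε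
  unfold Learner.SucceedsOn
  rw [hempty, measure_empty]
  exact zero_le

/-! ### Numerical estimates for the sample size. -/

lemma half_le_log_two_add {r : ℝ} (hr : 0 ≤ r) : 1 / 2 ≤ Real.log (2 + r) := by
  have := Real.log_le_log (by norm_num) (by linarith : (2 : ℝ) ≤ 2 + r)
  linarith [Real.log_two_gt_d9]

/-- The sample size occurs inside the logarithm it must dominate. Splitting off `log (m / Q) ≤ m /
Q` trades it for a small multiple of `m`, uniformly in `m`. -/
lemma log_mul_le_add_div {d m P Q N : ℝ} (hd : 0 < d) (hm : 0 < m) (hP : 0 < P) (hQ : 0 < Q)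
    (hN : 0 < N) (h : N ≤ m * P) : Real.log (d * N) ≤ Real.log d + m / Q + Real.log (Q * P) := by
  have h1 : Real.log (m / Q) ≤ m / Q := by
    linarith [Real.log_le_sub_one_of_pos (div_pos hm hQ)]
  have h2 : m * P = m / Q * (Q * P) := by field_simp
  have h3 : Real.log N ≤ Real.log (m / Q) + Real.log (Q * P) := by
    rw [← Real.log_mul (div_pos hm hQ).ne' (mul_pos hQ hP).ne', ← h2]
    exact Real.log_le_log hN h
  rw [Real.log_mul hd.ne' hN.ne']
  linarith

/-- The argument is at most `(2 + r) ^ 7 / e ^ 3`, because `k / ε ^ 2`, `1 / ε` and `B` are all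
controlled by `r`. -/
lemma log_scale_le {k B ε e r : ℝ} (hk : 0 < k) (hB : 0 ≤ B) (hε : 0 < ε) (he : 0 < e)
    (he1 : e ≤ 1) (hr : 0 < r) (hkr : k ≤ 2 * (r * ε ^ 2)) (hεr : 1 / ε ≤ 2 * r) (hBr : B ≤ 1 + r) :
    Real.log (2 * k / (ε * e) ^ 2 * (2 * (B + 1) / (ε * e) + 2)) ≤
      (7 - 6 * Real.log e) * Real.log (2 + r) := by
  have hL := half_le_log_two_add hr.le
  have hℓ : Real.log e ≤ 0 := Real.log_nonpos he.le he1
  have hQ : 2 * k / (ε * e) ^ 2 ≤ (2 + r) ^ 3 / e ^ 2 := by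
    have h1 : 4 * r ≤ (2 + r) ^ 3 := by nlinarith [pow_pos hr 2, pow_pos hr 3]
    calc 2 * k / (ε * e) ^ 2 ≤ 2 * (2 * (r * ε ^ 2)) / (ε * e) ^ 2 := by gcongr
      _ = 4 * r / e ^ 2 := by field_simp; norm_num
      _ ≤ _ := by gcongr
  have hP : 2 * (B + 1) / (ε * e) + 2 ≤ (2 + r) ^ 4 / e := by
    have h3 : 2 * (B + 1) / (ε * e) ≤ 2 * (2 + r) * (2 * r) / e := by
      calc 2 * (B + 1) / (ε * e) = 2 * (B + 1) * (1 / ε) / e := by field_simp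
        _ ≤ _ := div_le_div_of_nonneg_right
          (mul_le_mul (by linarith) hεr (by positivity) (by positivity)) he.le
    have h4 : 2 ≤ 2 / e := by
      rw [le_div_iff₀ he]
      linarith
    calc 2 * (B + 1) / (ε * e) + 2 ≤ 2 * (2 + r) * (2 * r) / e + 2 / e := by linarith
      _ = (2 * (2 + r) * (2 * r) + 2) / e := by ring
      _ ≤ _ := by
        gcongr
        nlinarith [pow_pos hr 2, pow_pos hr 3, pow_pos hr 4]
  calc Real.log (2 * k / (ε * e) ^ 2 * (2 * (B + 1) / (ε * e) + 2))
      ≤ Real.log ((2 + r) ^ 7 / e ^ 3) := by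
        refine Real.log_le_log (by positivity) ((mul_le_mul hQ hP (by positivity)
          (by positivity)).trans (le_of_eq ?_))
        field_simp
    _ = 7 * Real.log (2 + r) - 3 * Real.log e := by
        rw [Real.log_div (by positivity) (by positivity), Real.log_pow, Real.log_pow]
        norm_num
    _ ≤ _ := by
        linarith [mul_nonneg (neg_nonneg.2 hℓ) (by linarith : 0 ≤ 2 * Real.log (2 + r) - 1)]

/-- The metric entropy term is dominated by the sample size. -/
lemma entropy_le {d k M : ℕ} {B ε e m : ℝ} (hd : 2 ≤ d) (hB : 0 ≤ B) (hε : 0 < ε) (hε1 : ε < 1)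
    (he : 0 < e) (he1 : e ≤ 1) (hm : 1 ≤ m) (hM : M ≤ 2 * (B + 1) / (ε * e) + 1)
    (hmr : 4 * (8 - 6 * Real.log e) / e ^ 2 * rate d k B ε * Real.log (2 + rate d k B ε) ≤ m) :
    k * Real.log (d * (m * M + 1)) ≤ m * (ε * e) ^ 2 := by
  rcases Nat.eq_zero_or_pos k with rfl | hk
  · simp only [Nat.cast_zero, zero_mul]
    positivity
  have hk1 : (1 : ℝ) ≤ k := by exact_mod_cast hk
  have hd2 : (2 : ℝ) ≤ d := by exact_mod_cast hd
  have hlogd : 1 / 2 ≤ Real.log d := by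
    have := Real.log_le_log (by norm_num) hd2
    linarith [Real.log_two_gt_d9]
  have hrε : rate d k B ε * ε ^ 2 = k * Real.log d + B ^ 2 := by
    rw [rate]
    field_simp
  have hr0 : 0 < rate d k B ε := div_pos (by nlinarith [sq_nonneg B]) (by positivity)
  generalize rate d k B ε = r at *
  have hkl : k * Real.log d ≤ r * ε ^ 2 := by nlinarith
  have hkr : (k : ℝ) ≤ 2 * (r * ε ^ 2) := by nlinarith
  have hε2 : ε ^ 2 ≤ 1 := pow_le_one₀ hε.le hε1.le
  have hεr : 1 / ε ≤ 2 * r := by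
    rw [div_le_iff₀ hε]
    nlinarith [mul_pos hr0 hε]
  have hBr : B ≤ 1 + r := by
    have h1 : r * ε ^ 2 ≤ r * 1 := by gcongr
    have h2 : 0 ≤ k * Real.log d := by positivity
    refine abs_le_of_sq_le_sq' ?_ (by linarith) |>.2
    nlinarith
  have hL := half_le_log_two_add hr0.le
  have hℓ : Real.log e ≤ 0 := Real.log_nonpos he.le he1
  have hscale := log_scale_le (by linarith) hB hε he he1 hr0 hkr hεr hBr
  have hlog := log_mul_le_add_div (d := d) (m := m) (P := 2 * (B + 1) / (ε * e) + 2)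
    (Q := 2 * k / (ε * e) ^ 2) (N := m * M + 1) (by linarith) (by linarith) (by positivity)
    (by positivity) (by positivity) (by nlinarith)
  generalize Real.log (2 + r) = L at *
  have hkQ : k * (m / (2 * k / (ε * e) ^ 2)) = m * (ε * e) ^ 2 / 2 := by
    field_simp
  have hmr' : 4 * (8 - 6 * Real.log e) * (r * ε ^ 2) * L ≤ m * (ε * e) ^ 2 := by
    calc 4 * (8 - 6 * Real.log e) * (r * ε ^ 2) * L
        = (4 * (8 - 6 * Real.log e) / e ^ 2 * r * L) * (ε * e) ^ 2 := by field_simp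
      _ ≤ _ := by gcongr
  have hKL : k * ((7 - 6 * Real.log e) * L) ≤ 2 * (r * ε ^ 2) * ((7 - 6 * Real.log e) * L) :=
    mul_le_mul_of_nonneg_right hkr (mul_nonneg (by linarith) (by linarith))
  have h2L : r * ε ^ 2 ≤ r * ε ^ 2 * (2 * L) :=
    le_mul_of_one_le_right (by positivity) (by linarith)
  -- `Q` was chosen so that `m / Q` uses half of the budget `m * (ε * e) ^ 2`. The two other terms
  -- sum to at most `2 * (8 - 6 * log e) * (r * ε ^ 2) * L`, which is within the other half.
  calc k * Real.log (d * (m * M + 1))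
      ≤ k * (Real.log d + m / (2 * k / (ε * e) ^ 2) + (7 - 6 * Real.log e) * L) :=
        mul_le_mul_of_nonneg_left (by linarith) (by linarith)
    _ = k * Real.log d + k * (m / (2 * k / (ε * e) ^ 2)) + k * ((7 - 6 * Real.log e) * L) := by
        ring
    _ ≤ m * (ε * e) ^ 2 := by
        rw [hkQ]
        linarith

/-- The risk minimizer succeeds on samples of the size of the leading term, up to a logarithm. -/
lemma riskMinimizer_succeedsOn_classH20 {d k : ℕ} {B ε δ : ℝ} (hd : 2 ≤ d) (hB : 0 ≤ B)
    (hε : 0 < ε) (hε1 : ε < 1) (hδ : 0 < δ) (hδ1 : δ < 1) {h : ℕ → UnitBall d → ℝ}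
    (h0 : h 0 = fun _ => 0) (hmem : ∀ i, h i ∈ classH20 d k B)
    (hdense : ∀ f ∈ classH20 d k B, ∀ η > 0, ∃ i, ∀ x, |h i x - f x| ≤ η) {m : ℕ} (hm : 0 < m)
    (hmr : 4 * (8 - 6 * Real.log (δ / 64)) / (δ / 64) ^ 2 * rate d k B ε *
      Real.log (2 + rate d k B ε) ≤ m) (D : Measure (UnitBall d × Label))
    [IsProbabilityMeasure D] :
    (riskMinimizer h (fun i => measurable_of_mem_classH20 (hmem i)) hε).SucceedsOn rampLoss
      (classH20 d k B) ε δ m D := by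
  set e := δ / 64 with he
  have he0 : 0 < e := by positivity
  have he1 : e ≤ 1 := by rw [he]; linarith
  have hm' : (1 : ℝ) ≤ m := by exact_mod_cast hm
  set c := ε * e with hc
  have hc0 : 0 < c := by positivity
  set M := ⌈2 * (B + 1) / c⌉₊ with hM
  have hM1 : 2 * (B + 1) / c ≤ M := Nat.le_ceil _
  have hM2 : (M : ℝ) ≤ 2 * (B + 1) / c + 1 := (Nat.ceil_lt_add_one (by positivity)).le
  have hent := entropy_le hd hB hε hε1 he0 he1 hm' hM2 hmr
  have hd1 : (1 : ℝ) ≤ d := by exact_mod_cast (by omega : 1 ≤ d)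
  have hlog0 : 0 ≤ Real.log d := Real.log_nonneg hd1
  set r := rate d k B ε with hr
  have hrε : r * ε ^ 2 = k * Real.log d + B ^ 2 := by
    rw [hr, rate]
    field_simp
  have hr0 : 0 ≤ r := by rw [hr, rate]; positivity
  have hBm : B ^ 2 ≤ m * c ^ 2 := by
    have h1 : r / e ^ 2 ≤ m := by
      refine le_trans ?_ hmr
      have hL := half_le_log_two_add hr0
      have hℓ : Real.log e ≤ 0 := Real.log_nonpos he0.le he1
      calc r / e ^ 2 = r / e ^ 2 * 1 := by ring
        _ ≤ r / e ^ 2 * (4 * (8 - 6 * Real.log e) * Real.log (2 + r)) := by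
            gcongr
            nlinarith
        _ = _ := by ring
    rw [div_le_iff₀ (by positivity)] at h1
    have h2 : B ^ 2 ≤ r * ε ^ 2 := by
      rw [hrε]
      linarith [mul_nonneg (Nat.cast_nonneg (α := ℝ) k) hlog0]
    calc B ^ 2 ≤ r * ε ^ 2 := h2
      _ ≤ (m * e ^ 2) * ε ^ 2 := by gcongr
      _ = _ := by rw [hc]; ring
  have hBsqrt : B * √m ≤ m * c := by
    refine abs_le_of_sq_le_sq' ?_ (by positivity) |>.2
    rw [mul_pow, Real.sq_sqrt (by positivity)]
    nlinarith
  have hterm : k * Real.log (d * (m * M + 1)) / c ≤ m * c := by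
    rw [div_le_iff₀ hc0]
    linarith
  refine riskMinimizer_succeedsOn hmem (fun f hf => measurable_of_mem_classH20 hf) h0 hdense hε hm
    (R := B * √m + k * Real.log (d * (m * M + 1)) / c + c * m / 2 + c * m) ?_ ?_ ?_ D
  · have : 0 ≤ Real.log (d * (m * M + 1)) := Real.log_nonneg (by
      have : (0 : ℝ) ≤ m * M := by positivity
      nlinarith)
    positivity
  · intro N z
    exact sum_iSup_gain_le (by omega) (fun t : Fin (N + 1) => hmem t) hB hc0 hM1 z
  -- The four terms of `R` are at most `m * c`, `m * c`, `m * c / 2` and `m * c`, so `16 * R ≤ 56 *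
  -- (m * c)`.
  · have : δ * (m * ε) = 64 * (m * c) := by rw [hc, he]; ring
    rw [this]
    nlinarith [mul_pos (zero_lt_one.trans_le hm') hc0]

end RulesFirst

/-! ### The sample complexity bound. -/

theorem theorem1 :
    ∃ c : ℕ, ∀ δ : ℝ, 0 < δ → δ < 1 → ∃ C : ℝ, 0 < C ∧
      ∀ (d k : ℕ) (B ε : ℝ), 2 ≤ d → 0 ≤ B → 0 < ε → ε < 1 →
        ∃ n : ℕ,
          RulesFirst.sampleComplexity RulesFirst.rampLoss (RulesFirst.classH20 d k B) ε δ = n ∧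
          (n : ℝ) ≤ C * RulesFirst.rate d k B ε *
            Real.log (2 + RulesFirst.rate d k B ε) ^ c := by
  refine ⟨1, fun δ hδ hδ1 => ?_⟩
  set C₀ : ℝ := 4 * (8 - 6 * Real.log (δ / 64)) / (δ / 64) ^ 2 with hC₀
  have hℓ : Real.log (δ / 64) ≤ 0 := Real.log_nonpos (by positivity) (by linarith)
  have hC4 : 4 ≤ C₀ := by
    rw [hC₀, le_div_iff₀ (by positivity)]
    nlinarith
  refine ⟨2 * C₀, by linarith, fun d k B ε hd hB hε hε1 => ?_⟩
  set r := RulesFirst.rate d k B ε with hr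
  have hd2 : (2 : ℝ) ≤ d := by exact_mod_cast hd
  have hlogd : 1 / 2 ≤ Real.log d := by
    have := Real.log_le_log (by norm_num) hd2
    linarith [Real.log_two_gt_d9]
  have hr0 : 0 ≤ r := by
    rw [hr, RulesFirst.rate]
    positivity
  have hL := RulesFirst.half_le_log_two_add hr0
  have hrε : r * ε ^ 2 = k * Real.log d + B ^ 2 := by
    rw [hr, RulesFirst.rate]
    field_simp
  rw [pow_one]
  -- For small `r` the bound may be below `1`, so the complexity must be exactly `0`; `r < 1 / 2`
  -- forces `k = 0` and then `B ≤ ε`. For `r ≥ 1 / 2` the bound before rounding is at least `1`, and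
  -- the ceiling costs the factor `2` in `2 * C₀`.
  rcases lt_or_ge r (1 / 2) with hsmall | hlarge
  · have hk : k = 0 := by
      by_contra hk
      have : (1 : ℝ) ≤ k := by exact_mod_cast Nat.one_le_iff_ne_zero.2 hk
      nlinarith [sq_nonneg B]
    subst hk
    have hBε : B ≤ ε := abs_le_of_sq_le_sq' (by
      simp only [Nat.cast_zero, zero_mul, zero_add] at hrε
      nlinarith) hε.le |>.2
    refine ⟨0, RulesFirst.sampleComplexity_eq_zero hB hBε, ?_⟩
    rw [Nat.cast_zero]
    positivity
  · obtain ⟨h, h0, hmem, hdense⟩ := RulesFirst.exists_dense_seq_classH20 d k B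
    have hbig : 1 ≤ C₀ * r * Real.log (2 + r) := by
      have : 2 ≤ C₀ * r := by nlinarith
      nlinarith
    have hle := RulesFirst.sampleComplexity_le (loss := RulesFirst.rampLoss)
      (H := RulesFirst.classH20 d k B) (δ := δ)
      (RulesFirst.riskMinimizer h (fun i => RulesFirst.measurable_of_mem_classH20 (hmem i)) hε)
      (n := ⌈C₀ * r * Real.log (2 + r)⌉₊) fun m hm D _ => by
        have hm' : C₀ * r * Real.log (2 + r) ≤ m := Nat.ceil_le.1 hm
        refine RulesFirst.riskMinimizer_succeedsOn_classH20 hd hB hε hε1 hδ hδ1 h0 hmem hdense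
          ?_ hm' D
        exact_mod_cast zero_lt_one.trans_le (hbig.trans hm')
    obtain ⟨n, hn⟩ := ENat.ne_top_iff_exists.1 (ne_top_of_le_ne_top (ENat.natCast_ne_top _) hle)
    refine ⟨n, hn.symm, ?_⟩
    rw [← hn, Nat.cast_le] at hle
    have h1 : (n : ℝ) ≤ (⌈C₀ * r * Real.log (2 + r)⌉₊ : ℝ) := by exact_mod_cast hle
    have h2 := Nat.ceil_lt_add_one (zero_le_one.trans hbig)
    linarith
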